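/- Let $n,s,m$ be positive integers with $n\ge 3s$. A binary form of degree $n$ is a homogeneous polynomial of degree $n$ in two variables. For an integer $t\ge 0$ let $C(t)$ be the set of binary forms $F(x,y)\in\mathbb{Z}[x,y]$ of degree $n$ that are irreducible over $\mathbb{Q}$ and such that, for all reals $(u,v)\neq(0,0)$, the form $u\,\partial F/\partial x+v\,\partial F/\partial y$ has at most $t$ distinct zeros in $\mathbb{P}^1(\mathbb{R})$. For a form $G(x,y)=a_n(x-\gamma_1y)\cdots(x-\gamma_ny)$ with $a_n\ne0$, let $M(G)=|a_n|\prod_{i=1}^n\max(1,|\gamma_i|)$ be its Mahler measure. Two forms $F,G$ are equivalent if $G(x,y)=\pm F(ax+by,cx+dy)$ for some $\begin{pmatrix}a&b\\c&d\end{pmatrix}\in GL_2(\mathbb{Z})$. Put $$R=n^{800\log^2 n},\qquad Y_S=\bigl((e^6s)^nR^{2s}m\bigr)^{\frac1{n-2s}}.$$ Let $F\in C(4s-2)$ have degree $n$, let $M$ be the smallest Mahler measure among the forms equivalent to $F$, and suppose that $m\le M/100^n$. Let $\tilde P_{S_x}(F,m)$ and $\tilde P_{S_y}(F,m)$ be the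 numbers of pairs $(x,y)\in\mathbb{Z}^2$ with $\gcd(x,y)=1$ and $$2^{-n}m\le F(x,y)<m$$ that satisfy $0\le x\le Y_S$ and $0\le y\le Y_S$, respectively. Then both numbers are finite and $$\max\bigl(\tilde P_{S_x}(F,m),\tilde P_{S_y}(F,m)\bigr)\ll s+\log^3 n+\log m^{1/n},$$ where the implied constant is absolute. -/

import Mathlib

namespace ThueForms

noncomputable section

/-- `F_A(x, y) = F(a x + b y, c x + d y)` for `A = (a b; c d)`. -/
def act (A : Matrix (Fin 2) (Fin 2) ℤ) (F : MvPolynomial (Fin 2) ℤ) : MvPolynomial (Fin 2) ℤ :=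
  MvPolynomial.bind₁
    (fun i => MvPolynomial.C (A i 0) * MvPolynomial.X 0 +
      MvPolynomial.C (A i 1) * MvPolynomial.X 1) F

/-- `F` and `G` are equivalent if `G = ± F_A` for some `A ∈ GL₂(ℤ)`. -/
def Equivalent (F G : MvPolynomial (Fin 2) ℤ) : Prop :=
  ∃ A : Matrix.GeneralLinearGroup (Fin 2) ℤ,
    G = act (A : Matrix (Fin 2) (Fin 2) ℤ) F ∨ G = -act (A : Matrix (Fin 2) (Fin 2) ℤ) F

/-- The zeros of a real binary form in the real projective line. -/
def realZeros (G : MvPolynomial (Fin 2) ℝ) : Set (Projectivization ℝ (Fin 2 → ℝ)) :=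
  {P | ∀ v ∈ P.submodule, MvPolynomial.eval v G = 0}

/-- `F` with coefficients regarded as real numbers. -/
def toReal (F : MvPolynomial (Fin 2) ℤ) : MvPolynomial (Fin 2) ℝ :=
  MvPolynomial.map (Int.castRingHom ℝ) F

/-- The class `C(t)` of forms of degree `n`: integral binary forms, irreducible over `ℚ`, such that
for all reals `(u, v) ≠ (0, 0)` the form `u F_x + v F_y` has at most `t` (distinct) real zeros. -/
structure ClassC (n t : ℕ) (F : MvPolynomial (Fin 2) ℤ) : Prop where
  homogeneous : F.IsHomogeneous n
  irreducible : Irreducible (MvPolynomial.map (Int.castRingHom ℚ) F)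
  few_zeros : ∀ u v : ℝ, (u, v) ≠ (0, 0) →
    (realZeros (MvPolynomial.C u * MvPolynomial.pderiv 0 (toReal F) +
      MvPolynomial.C v * MvPolynomial.pderiv 1 (toReal F))).encard ≤ t

/-- The Mahler measure `M(F)` of a binary form, i.e. the Mahler measure of `F(x, 1)`. -/
def mahler (F : MvPolynomial (Fin 2) ℤ) : ℝ :=
  (MvPolynomial.aeval ![(Polynomial.X : Polynomial ℂ), 1] F).mahlerMeasure

/-- `M(F) = |a| ∏ max(1, |γᵢ|)` with `a` the leading coefficient and `γᵢ` the roots of `F(x, 1)`. -/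
theorem mahler_eq (F : MvPolynomial (Fin 2) ℤ) :
    mahler F =
      ‖(MvPolynomial.aeval ![(Polynomial.X : Polynomial ℂ), 1] F).leadingCoeff‖ *
        ((MvPolynomial.aeval ![(Polynomial.X : Polynomial ℂ), 1] F).roots.map
          (fun γ => max 1 ‖γ‖)).prod :=
  Polynomial.mahlerMeasure_eq_leadingCoeff_mul_prod_roots _

/-- The smallest Mahler measure among the forms equivalent to `F`. -/
def minMahler (F : MvPolynomial (Fin 2) ℤ) : ℝ :=
  sInf {M : ℝ | ∃ G, Equivalent F G ∧ M = mahler G}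

/-- `R = n ^ (800 log² n)`. -/
def R (n : ℕ) : ℝ := (n : ℝ) ^ (800 * Real.log n ^ 2)

/-- `Y_S = ((e⁶ s)ⁿ R^{2s} m)^{1/(n-2s)}`. -/
def YS (n s m : ℕ) : ℝ :=
  ((Real.exp 6 * s) ^ n * R n ^ (2 * s) * m) ^ (1 / ((n : ℝ) - 2 * s))

/-- `(x, y)` is a primitive solution of `2^{-n} m ≤ F(x, y) < m`. -/
def IsPrimitiveSolution (n m : ℕ) (F : MvPolynomial (Fin 2) ℤ) (x y : ℤ) : Prop :=
  IsCoprime x y ∧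
    (2 : ℝ) ^ (-(n : ℤ)) * m ≤ (MvPolynomial.eval ![x, y] F : ℤ) ∧
    ((MvPolynomial.eval ![x, y] F : ℤ) : ℝ) < m

/-- The primitive solutions with `0 ≤ x ≤ Y_S`. -/
def smallX (n s m : ℕ) (F : MvPolynomial (Fin 2) ℤ) : Set (ℤ × ℤ) :=
  {p | IsPrimitiveSolution n m F p.1 p.2 ∧ 0 ≤ p.1 ∧ (p.1 : ℝ) ≤ YS n s m}

/-- The primitive solutions with `0 ≤ y ≤ Y_S`. -/
def smallY (n s m : ℕ) (F : MvPolynomial (Fin 2) ℤ) : Set (ℤ × ℤ) :=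
  {p | IsPrimitiveSolution n m F p.1 p.2 ∧ 0 ≤ p.2 ∧ (p.2 : ℝ) ≤ YS n s m}

end

end ThueForms

namespace ThueForms
open Polynomial

/-! Write `F(x, y) = a ∏ (x - αᵢ y)`. Swapping the variables reduces everything to solutions with
bounded `y`; those with `y = 0` number at most two.

If `0 < F(x, y) < m`, complete `(x, y)` to a unimodular matrix. The transformed form has Mahler
measure at least `100ⁿ m`, while `|a| ∏ |x - αᵢ y| < m`; hence `∏ᵢ max(1, 1/(y|x - αᵢ y|)) ≥ 50ⁿ`
(`prod_max_ge_of_unimodular`): on geometric average `x/y` is very close to the roots. For one fixed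
root, however, the gap principle bounds the product of these factors over a set `T` of solutions by
`2^|T| B`, where `B` bounds every `1/(2|x - αᵢ y|)` (`prod_max_one_le_of_gap`). Comparing the two
gives `25^|T| ≤ B`, so `|T| ≤ log B`.

The few-zeros condition makes `B` small. Apart from `O(s)` exceptions, a point `x/y` has
neighbouring solutions on both sides with no critical point of `F(t, 1)` between them. Thus `F(t,
1)` is positive and monotone there, and `|F(t, 1)|` is maximal at `x/y` on the segment to one
neighbour. A Bernstein-type estimate (`norm_sub_le_mul_norm_sub_root`) keeps all roots away from
such a maximum, on the scale of the segment. Distinct fractions with denominators at most `Y` are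
separated, so `B = 72 n⁴ Y` works, and `log Y_S` has the required size. -/

/-! ### Distance from a maximum on a segment to the roots. -/

/-- The coefficients of a polynomial are bounded by its maximum on the unit circle. -/
theorem norm_coeff_le_of_norm_eval_le (q : ℂ[X]) {C : ℝ}
    (hC : ∀ w : ℂ, ‖w‖ = 1 → ‖q.eval w‖ ≤ C) (k : ℕ) : ‖q.coeff k‖ ≤ C := by
  have hd : DiffContOnCl ℂ (fun z => q.eval z) (Metric.ball 0 1) :=
    q.differentiable.diffContOnCl
  have h := Complex.norm_iteratedDeriv_le_of_forall_mem_sphere_norm_le k one_pos hd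
    (fun z hz => hC z (by simpa using hz))
  have h2 : iteratedDeriv k (fun z => q.eval z) 0 = (k.factorial : ℂ) * q.coeff k := by
    have h3 : ∀ j, iteratedDeriv j (fun z => q.eval z) = fun z => (derivative^[j] q).eval z := by
      intro j
      induction j with
      | zero => simp
      | succ j ih =>
        rw [iteratedDeriv_succ, ih, Function.iterate_succ_apply']
        ext z
        exact Polynomial.deriv _
    simp only [h3]
    rw [← coeff_zero_eq_eval_zero, coeff_iterate_derivative]
    simp [Nat.descFactorial_self]
  rw [h2, norm_mul, Complex.norm_natCast, one_pow, div_one] at h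
  exact le_of_mul_le_mul_left h (by positivity)

theorem norm_pow_sub_one_le {w : ℂ} (hw : ‖w‖ ≤ 1) (k : ℕ) : ‖w ^ k - 1‖ ≤ k * ‖w - 1‖ := by
  induction k with
  | zero => simp
  | succ k ih =>
    have : w ^ (k + 1) - 1 = w * (w ^ k - 1) + (w - 1) := by ring
    rw [this]
    refine (norm_add_le _ _).trans ?_
    rw [norm_mul]
    push_cast
    nlinarith [norm_nonneg (w ^ k - 1), norm_nonneg w]

/-- Subtracting `q(w) = 0` turns `q(1)` into a sum of terms `cₖ (1 - wᵏ)`, with `|cₖ| ≤ C` by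
Cauchy's estimate. In the application `|q(1)| = C`, so no root in the closed disc is very near `1`.
-/
theorem norm_eval_one_le_of_root (q : ℂ[X]) {C : ℝ} {d : ℕ} (hd : q.natDegree ≤ d)
    (hC : ∀ w : ℂ, ‖w‖ = 1 → ‖q.eval w‖ ≤ C) {w : ℂ} (hw : ‖w‖ ≤ 1) (h0 : q.eval w = 0) :
    ‖q.eval 1‖ ≤ (d + 1) * (C * (d * ‖w - 1‖)) := by
  have hC0 : 0 ≤ C := (norm_nonneg _).trans (hC 1 (by simp))
  have e : q.eval 1 = -∑ k ∈ Finset.range (d + 1), q.coeff k * (w ^ k - 1) := by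
    have h1 := Polynomial.eval_eq_sum_range' (Nat.lt_succ_of_le hd) (1 : ℂ)
    have h2 := Polynomial.eval_eq_sum_range' (Nat.lt_succ_of_le hd) w
    simp only [mul_sub, Finset.sum_sub_distrib]
    simp only [one_pow, Nat.succ_eq_add_one] at h1 h2
    rw [← h1, ← h2, h0]
    ring
  rw [e, norm_neg]
  refine (norm_sum_le _ _).trans ?_
  have : ∀ k ∈ Finset.range (d + 1), ‖q.coeff k * (w ^ k - 1)‖ ≤ C * (d * ‖w - 1‖) := by
    intro k hk
    rw [norm_mul]
    have hk' : (k : ℝ) ≤ d := by exact_mod_cast Nat.lt_succ_iff.1 (Finset.mem_range.1 hk)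
    refine mul_le_mul (norm_coeff_le_of_norm_eval_le q hC k) ?_ (norm_nonneg _) hC0
    exact (norm_pow_sub_one_le hw k).trans (by gcongr)
  refine (Finset.sum_le_card_nsmul _ _ _ this).trans ?_
  simp

/-- The equation is quadratic in `w` with product of roots `1`, so one root lies in the closed unit
disc. It inverts `σ = -(w - 1)²/(4w)`, which maps the unit circle onto `[0, 1]`. -/
theorem exists_joukowski (σ : ℂ) : ∃ w : ℂ, ‖w‖ ≤ 1 ∧ (w - 1) ^ 2 = -4 * σ * w := by
  obtain ⟨r, hr⟩ := IsAlgClosed.exists_pow_nat_eq (σ ^ 2 - σ) (n := 2) (by norm_num)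
  have hp : ‖1 - 2 * σ + 2 * r‖ * ‖1 - 2 * σ - 2 * r‖ = 1 := by
    rw [← norm_mul, show (1 - 2 * σ + 2 * r) * (1 - 2 * σ - 2 * r) = 1 by linear_combination -4 * hr]
    simp
  rcases le_total ‖1 - 2 * σ + 2 * r‖ 1 with h | h
  · exact ⟨_, h, by linear_combination 4 * hr⟩
  · exact ⟨1 - 2 * σ - 2 * r, by nlinarith [norm_nonneg (1 - 2 * σ - 2 * r)],
      by linear_combination 4 * hr⟩

/-- If a polynomial of degree `n` attains its maximum modulus over the segment from `b` to `a` at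
`b`, then its roots are not much closer to `b` than `a` is. -/
theorem norm_sub_le_mul_norm_sub_root {ι : Type*} [Fintype ι] (α : ι → ℂ) (a b : ℂ)
    (hmax : ∀ t : ℝ, 0 ≤ t → t ≤ 1 → ‖∏ j, (b + t * (a - b) - α j)‖ ≤ ‖∏ j, (b - α j)‖)
    (hb : ∏ j, (b - α j) ≠ 0) (i : ι) :
    ‖a - b‖ ≤ 144 * (Fintype.card ι : ℝ) ^ 4 * ‖b - α i‖ := by
  rcases eq_or_ne a b with rfl | hab
  · simp only [sub_self, norm_zero]; positivity
  have hab' : a - b ≠ 0 := sub_ne_zero.2 hab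
  set n := Fintype.card ι with hn
  have hn1 : 1 ≤ n := Fintype.card_pos_iff.2 ⟨i⟩
  -- For `w ≠ 0` this is `wⁿ ∏ (b + σ(a - b) - αⱼ)` with `σ = -(w - 1)²/(4w)`: the circle traverses
  -- the segment, and `w = 1` corresponds to `b`.
  set q : ℂ[X] := ∏ j, (C (b - α j) * X - C ((a - b) / 4) * (X - 1) ^ 2) with hq
  have hev : ∀ w, q.eval w = ∏ j, ((b - α j) * w - (a - b) / 4 * (w - 1) ^ 2) := by
    intro w; simp [hq, eval_prod]
  have hdeg : q.natDegree ≤ 2 * n := by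
    refine (natDegree_prod_le _ _).trans ?_
    refine (Finset.sum_le_card_nsmul _ _ 2 fun j _ => ?_).trans (by simp [hn, mul_comm])
    compute_degree
  have hC : ∀ w : ℂ, ‖w‖ = 1 → ‖q.eval w‖ ≤ ‖∏ j, (b - α j)‖ := by
    intro w hw
    have hw2 : w * (starRingEnd ℂ) w = 1 := by
      rw [Complex.mul_conj, Complex.normSq_eq_norm_sq, hw]; simp
    have ht : (w - 1) ^ 2 = -((‖w - 1‖ ^ 2 : ℝ) : ℂ) * w := by
      have : ((‖w - 1‖ ^ 2 : ℝ) : ℂ) = (w - 1) * (starRingEnd ℂ) (w - 1) := by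
        rw [Complex.mul_conj, Complex.normSq_eq_norm_sq]
      rw [this, map_sub, map_one]
      linear_combination (w - 1) * hw2
    have hw1 : ‖w - 1‖ ≤ 2 := (norm_sub_le _ _).trans (by rw [hw]; norm_num)
    have := hmax (‖w - 1‖ ^ 2 / 4) (by positivity) (by nlinarith [norm_nonneg (w - 1)])
    refine le_trans (le_of_eq ?_) this
    rw [hev, norm_prod, norm_prod]
    refine Finset.prod_congr rfl fun j _ => ?_
    rw [ht, show (b - α j) * w - (a - b) / 4 * (-((‖w - 1‖ ^ 2 : ℝ) : ℂ) * w) =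
      (b + ((‖w - 1‖ ^ 2 / 4 : ℝ) : ℂ) * (a - b) - α j) * w by push_cast; ring, norm_mul, hw, mul_one]
  -- Pull the root `αᵢ` back to the disc. As `σ` is quadratic in `w - 1`, a lower bound of order
  -- `n⁻²` for `|w - 1|` gives the factor `n⁴`.
  obtain ⟨w, hw, hw2⟩ := exists_joukowski ((α i - b) / (a - b))
  have h0 : q.eval w = 0 := by
    rw [hev]
    refine Finset.prod_eq_zero (Finset.mem_univ i) ?_
    rw [hw2]; field_simp; ring
  have h1 := norm_eval_one_le_of_root q hdeg hC hw h0
  have h2 : q.eval 1 = ∏ j, (b - α j) := by rw [hev]; simp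
  rw [h2] at h1
  have hpos : 0 < ‖∏ j, (b - α j)‖ := norm_pos_iff.2 hb
  have h3 : 1 ≤ 6 * (n : ℝ) ^ 2 * ‖w - 1‖ := by
    have h4 : 1 ≤ (2 * (n : ℝ) + 1) * (2 * n * ‖w - 1‖) := by
      push_cast at h1
      have : 1 * ‖∏ j, (b - α j)‖ ≤ ((2 * (n : ℝ) + 1) * (2 * n * ‖w - 1‖)) * ‖∏ j, (b - α j)‖ := by
        linarith
      exact le_of_mul_le_mul_right this hpos
    have hn1' : (1 : ℝ) ≤ n := by exact_mod_cast hn1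
    nlinarith [mul_nonneg (mul_nonneg (Nat.cast_nonneg (α := ℝ) n) (norm_nonneg (w - 1)))
      (sub_nonneg.2 hn1')]
  have h5 : ‖w - 1‖ ^ 2 * ‖a - b‖ ≤ 4 * ‖b - α i‖ := by
    have := congrArg norm hw2
    rw [norm_pow] at this
    rw [this, norm_mul, norm_mul, norm_div, norm_sub_rev (α i), norm_neg]
    have : ‖a - b‖ ≠ 0 := norm_ne_zero_iff.2 hab'
    have e : ‖(4 : ℂ)‖ * (‖b - α i‖ / ‖a - b‖) * ‖w‖ * ‖a - b‖ = 4 * ‖b - α i‖ * ‖w‖ := by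
      rw [show ‖(4 : ℂ)‖ = 4 by simp]; field_simp
    rw [e]
    exact mul_le_of_le_one_right (by positivity) hw
  have h6 : 1 ≤ (6 * (n : ℝ) ^ 2 * ‖w - 1‖) ^ 2 := one_le_pow₀ h3
  calc ‖a - b‖ ≤ (6 * (n : ℝ) ^ 2 * ‖w - 1‖) ^ 2 * ‖a - b‖ :=
        le_mul_of_one_le_left (norm_nonneg _) h6
    _ = 36 * (n : ℝ) ^ 4 * (‖w - 1‖ ^ 2 * ‖a - b‖) := by ring
    _ ≤ 36 * (n : ℝ) ^ 4 * (4 * ‖b - α i‖) := by gcongr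
    _ = _ := by ring

/-! ### Neighbouring points and critical points. -/

/-- All but few points of a finite set of reals have neighbours on both sides that are not
separated from each other by a point of `Z`. -/
theorem exists_exceptional_subset (A Z : Finset ℝ) :
    ∃ E ⊆ A, E.card ≤ 2 * Z.card + 2 ∧
      ∀ a ∈ A, a ∉ E → ∃ b ∈ A, ∃ c ∈ A, b < a ∧ a < c ∧ ∀ z ∈ Z, ¬(b < z ∧ z < c) := by
  classical
  -- The exceptions are the two extreme points and, for each `z`, the nearest point of `A` on either
  -- side of `z`.
  set E₁ := A.filter fun a => ∀ b ∈ A, a ≤ b with h₁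
  set E₂ := A.filter fun a => ∀ b ∈ A, b ≤ a with h₂
  set E₃ := Z.biUnion fun z => A.filter fun a => z ≤ a ∧ ∀ b ∈ A, z ≤ b → a ≤ b with h₃
  set E₄ := Z.biUnion fun z => A.filter fun a => a ≤ z ∧ ∀ b ∈ A, b ≤ z → b ≤ a with h₄
  refine ⟨(E₁ ∪ E₂) ∪ (E₃ ∪ E₄), ?_, ?_, ?_⟩
  · intro a ha
    simp only [h₁, h₂, h₃, h₄, Finset.mem_union, Finset.mem_filter, Finset.mem_biUnion] at ha
    tauto
  · have c₁ : E₁.card ≤ 1 := Finset.card_le_one.2 fun a ha b hb => by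
      rw [h₁, Finset.mem_filter] at ha hb
      exact le_antisymm (ha.2 b hb.1) (hb.2 a ha.1)
    have c₂ : E₂.card ≤ 1 := Finset.card_le_one.2 fun a ha b hb => by
      rw [h₂, Finset.mem_filter] at ha hb
      exact le_antisymm (hb.2 a ha.1) (ha.2 b hb.1)
    have c₃ : E₃.card ≤ Z.card * 1 := Finset.card_biUnion_le_card_mul _ _ _ fun z _ =>
      Finset.card_le_one.2 fun a ha b hb => by
        rw [Finset.mem_filter] at ha hb
        exact le_antisymm (ha.2.2 b hb.1 hb.2.1) (hb.2.2 a ha.1 ha.2.1)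
    have c₄ : E₄.card ≤ Z.card * 1 := Finset.card_biUnion_le_card_mul _ _ _ fun z _ =>
      Finset.card_le_one.2 fun a ha b hb => by
        rw [Finset.mem_filter] at ha hb
        exact le_antisymm (hb.2.2 a ha.1 ha.2.1) (ha.2.2 b hb.1 hb.2.1)
    have := Finset.card_union_le (E₁ ∪ E₂) (E₃ ∪ E₄)
    have := Finset.card_union_le E₁ E₂
    have := Finset.card_union_le E₃ E₄
    omega
  · intro a ha hE
    simp only [Finset.mem_union, not_or] at hE
    obtain ⟨⟨n₁, n₂⟩, n₃, n₄⟩ := hE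
    have hB : (A.filter (· < a)).Nonempty := by
      by_contra hne
      rw [Finset.not_nonempty_iff_eq_empty, Finset.filter_eq_empty_iff] at hne
      exact n₁ (Finset.mem_filter.2 ⟨ha, fun b hb => not_lt.1 (hne hb)⟩)
    have hC : (A.filter (a < ·)).Nonempty := by
      by_contra hne
      rw [Finset.not_nonempty_iff_eq_empty, Finset.filter_eq_empty_iff] at hne
      exact n₂ (Finset.mem_filter.2 ⟨ha, fun b hb => not_lt.1 (hne hb)⟩)
    have hb := Finset.mem_filter.1 ((A.filter (· < a)).max'_mem hB)
    have hc := Finset.mem_filter.1 ((A.filter (a < ·)).min'_mem hC)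
    refine ⟨_, hb.1, _, hc.1, hb.2, hc.2, fun z hz hbc => ?_⟩
    -- The chosen neighbours are adjacent to `a`, so a `z` between them makes `a` the nearest point
    -- of `A` on its side of `z`.
    rcases le_total z a with hza | hza
    · refine n₃ (Finset.mem_biUnion.2 ⟨z, hz, Finset.mem_filter.2 ⟨ha, hza, fun d hd hzd => ?_⟩⟩)
      by_contra hlt
      have := (A.filter (· < a)).le_max' d (Finset.mem_filter.2 ⟨hd, not_le.1 hlt⟩)
      linarith [hbc.1]
    · refine n₄ (Finset.mem_biUnion.2 ⟨z, hz, Finset.mem_filter.2 ⟨ha, hza, fun d hd hzd => ?_⟩⟩)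
      by_contra hlt
      have := (A.filter (a < ·)).min'_le d (Finset.mem_filter.2 ⟨hd, not_le.1 hlt⟩)
      linarith [hbc.2]

/-- On an interval without critical points a polynomial is monotone or antitone. -/
theorem monotoneOn_or_antitoneOn_of_derivative_ne_zero (f : ℝ[X]) {b c : ℝ}
    (h : ∀ t, b < t → t < c → f.derivative.eval t ≠ 0) :
    MonotoneOn (fun t => f.eval t) (Set.Icc b c) ∨ AntitoneOn (fun t => f.eval t) (Set.Icc b c) := by
  have hint : interior (Set.Icc b c) = Set.Ioo b c := interior_Icc
  have hderiv : ∀ t, deriv (fun t => f.eval t) t = f.derivative.eval t := fun t => f.deriv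
  rcases hasDerivWithinAt_forall_lt_or_forall_gt_of_forall_ne (f := fun t => f.eval t)
      (s := Set.Ioo b c) (m := 0) (convex_Ioo b c)
      (f' := fun t => f.derivative.eval t) (fun t _ => (f.hasDerivAt t).hasDerivWithinAt)
      (fun t ht => h t ht.1 ht.2) with hsign | hsign
  · exact Or.inr (antitoneOn_of_deriv_nonpos (convex_Icc b c) f.continuousOn
      f.differentiable.differentiableOn fun t ht => by
        rw [hint] at ht; rw [hderiv]; exact (hsign t ht).le)
  · exact Or.inl (monotoneOn_of_deriv_nonneg (convex_Icc b c) f.continuousOn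
      f.differentiable.differentiableOn fun t ht => by
        rw [hint] at ht; rw [hderiv]; exact (hsign t ht).le)

/-! ### Gap principle and the count of approximations. -/

/-- Gap principle: good rational approximations to a fixed number, with denominators bounded in
terms of `B`, cannot all be very good. -/
theorem prod_max_one_le_of_gap (T : Finset (ℤ × ℤ)) (α : ℂ) {B : ℝ} (hB : 1 ≤ B)
    (hy : ∀ p ∈ T, 1 ≤ p.2)
    (hdet : ∀ p ∈ T, ∀ q ∈ T, p ≠ q → p.1 * q.2 - q.1 * p.2 ≠ 0)
    (hl : ∀ p ∈ T, (0 : ℝ) < ‖(p.1 : ℂ) - α * p.2‖)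
    (hlB : ∀ p ∈ T, 1 / (2 * ‖(p.1 : ℂ) - α * p.2‖) ≤ B) :
    ∏ p ∈ T, max 1 (1 / (p.2 * ‖(p.1 : ℂ) - α * p.2‖)) ≤ 2 ^ T.card * B := by
  classical
  set l : ℤ × ℤ → ℝ := fun p => ‖(p.1 : ℂ) - α * p.2‖ with hldef
  -- The bound `B / c` is what makes the induction telescope. Remove the point `a` of smallest
  -- denominator: the determinant inequality `1 ≤ y_p l_a + y_a l_p ≤ y_p l_a + 1/2` shows that all
  -- remaining denominators are at least `1/(2 l_a)`, which serves as the new `c`.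
  have key : ∀ S : Finset (ℤ × ℤ), S ⊆ T → (∀ p ∈ S, p.2 * l p ≤ 1 / 2) → ∀ c : ℝ, 0 < c → c ≤ B →
      (∀ p ∈ S, c ≤ p.2) → ∏ p ∈ S, 1 / (2 * (p.2 * l p)) ≤ B / c := by
    intro S
    induction S using Finset.induction_on_min_value (fun p : ℤ × ℤ => p.2) with
    | empty =>
      intro _ _ c hc hcB _
      simpa using (one_le_div hc).2 hcB
    | insert a S ha hmin ih =>
      intro hST hsmall c hc hcB hcy
      rw [Finset.prod_insert ha]
      have haT : a ∈ T := hST (Finset.mem_insert_self _ _)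
      have hla : 0 < l a := hl a haT
      have hya : (1 : ℝ) ≤ a.2 := by exact_mod_cast hy a haT
      have hmain := ih ((Finset.subset_insert _ _).trans hST)
        (fun p hp => hsmall p (Finset.mem_insert_of_mem hp)) (1 / (2 * l a)) (by positivity)
        (hlB a haT) (fun p hp => by
          have hpT : p ∈ T := hST (Finset.mem_insert_of_mem hp)
          have hne : a ≠ p := fun h => ha (h ▸ hp)
          have hd : (1 : ℝ) ≤ ‖((a.1 * p.2 - p.1 * a.2 : ℤ) : ℂ)‖ := by
            rw [Complex.norm_intCast]
            exact_mod_cast Int.one_le_abs (hdet a haT p hpT hne)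
          have hyp : (1 : ℝ) ≤ p.2 := by exact_mod_cast hy p hpT
          have hap : (a.2 : ℝ) ≤ p.2 := by exact_mod_cast hmin p hp
          have e : ((a.1 * p.2 - p.1 * a.2 : ℤ) : ℂ) =
              (p.2 : ℂ) * ((a.1 : ℂ) - α * a.2) - (a.2 : ℂ) * ((p.1 : ℂ) - α * p.2) := by
            push_cast; ring
          have h1 : ‖((a.1 * p.2 - p.1 * a.2 : ℤ) : ℂ)‖ ≤ p.2 * l a + a.2 * l p := by
            rw [e]
            refine (norm_sub_le _ _).trans (le_of_eq ?_)
            rw [norm_mul, norm_mul, Complex.norm_intCast, Complex.norm_intCast,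
              abs_of_nonneg (by linarith), abs_of_nonneg (by linarith)]
          have h2 : (a.2 : ℝ) * l p ≤ p.2 * l p :=
            mul_le_mul_of_nonneg_right hap (norm_nonneg _)
          have h3 := hsmall p (Finset.mem_insert_of_mem hp)
          rw [div_le_iff₀ (by positivity)]
          linarith)
      calc 1 / (2 * (a.2 * l a)) * ∏ p ∈ S, 1 / (2 * (p.2 * l p))
          ≤ 1 / (2 * (a.2 * l a)) * (B / (1 / (2 * l a))) := by gcongr
        _ = B / a.2 := by field_simp
        _ ≤ B / c := by
          have := hcy a (Finset.mem_insert_self _ _)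
          gcongr
  have hpos : ∀ p ∈ T, 0 < (p.2 : ℝ) * l p := fun p hp =>
    mul_pos (by exact_mod_cast hy p hp) (hl p hp)
  have hk := key (T.filter fun p => p.2 * l p ≤ 1 / 2) (Finset.filter_subset _ _)
    (fun p hp => (Finset.mem_filter.1 hp).2) 1 one_pos hB
    (fun p hp => by exact_mod_cast hy p (Finset.mem_filter.1 hp).1)
  rw [Finset.prod_filter, div_one] at hk
  calc ∏ p ∈ T, max 1 (1 / (p.2 * l p))
      -- Points with `y l > 1/2` contribute a factor of at most `2`; the others fall under `key`.
      ≤ ∏ p ∈ T, 2 * (if p.2 * l p ≤ 1 / 2 then 1 / (2 * (p.2 * l p)) else 1) := by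
        refine Finset.prod_le_prod (fun p _ => by positivity) fun p hp => ?_
        have hp0 := hpos p hp
        split_ifs with h
        · rw [show 2 * (1 / (2 * (p.2 * l p))) = 1 / (p.2 * l p) by field_simp]
          refine max_le ?_ le_rfl
          rw [le_div_iff₀ hp0]; linarith
        · refine max_le (by norm_num) ?_
          rw [div_le_iff₀ hp0]; linarith
    _ = 2 ^ T.card * ∏ p ∈ T, (if p.2 * l p ≤ 1 / 2 then 1 / (2 * (p.2 * l p)) else 1) := by
        rw [Finset.prod_mul_distrib, Finset.prod_const]
    _ ≤ 2 ^ T.card * B := by gcongr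

/-- A point with a neighbour on either side, between which there is no critical point of a
polynomial positive at these points, is at a controlled distance from the roots. -/
theorem min_sub_le_of_neighbours {ι : Type*} [Fintype ι] (α : ι → ℂ) (a : ℂ) (f : ℝ[X])
    (hf : ∀ t : ℝ, ((f.eval t : ℝ) : ℂ) = a * ∏ i, ((t : ℂ) - α i)) {b c x : ℝ}
    (hbx : b < x) (hxc : x < c) (hfb : 0 < f.eval b) (hfx : 0 < f.eval x) (hfc : 0 < f.eval c)
    (hcrit : ∀ t, b < t → t < c → f.derivative.eval t ≠ 0) (i : ι) :
    min (x - b) (c - x) ≤ 144 * (Fintype.card ι : ℝ) ^ 4 * ‖(x : ℂ) - α i‖ := by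
  have hx0 : a * ∏ i, ((x : ℂ) - α i) ≠ 0 := by
    rw [← hf]; exact_mod_cast hfx.ne'
  have ha : a ≠ 0 := left_ne_zero_of_mul hx0
  have hnorm : ∀ t : ℝ, |f.eval t| = ‖a‖ * ‖∏ i, ((t : ℂ) - α i)‖ := by
    intro t
    rw [← norm_mul, ← hf, Complex.norm_real, Real.norm_eq_abs]
  have main : ∀ d : ℝ, (∀ t : ℝ, 0 ≤ t → t ≤ 1 → |f.eval (x + t * (d - x))| ≤ |f.eval x|) →
      |d - x| ≤ 144 * (Fintype.card ι : ℝ) ^ 4 * ‖(x : ℂ) - α i‖ := by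
    intro d hd
    have := norm_sub_le_mul_norm_sub_root α (d : ℂ) (x : ℂ) (fun t h0 h1 => by
      have h := hd t h0 h1
      rw [hnorm, hnorm] at h
      have h' := le_of_mul_le_mul_left h (norm_pos_iff.2 ha)
      push_cast at h'
      exact h') (right_ne_zero_of_mul hx0) i
    rwa [← Complex.ofReal_sub, Complex.norm_real, Real.norm_eq_abs] at this
  have hxm : x ∈ Set.Icc b c := ⟨hbx.le, hxc.le⟩
  have hbm : b ∈ Set.Icc b c := ⟨le_rfl, (hbx.trans hxc).le⟩
  have hcm : c ∈ Set.Icc b c := ⟨(hbx.trans hxc).le, le_rfl⟩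
  -- Go towards the neighbour with the smaller value: `f` decreases from `x` but stays positive, so
  -- `|f|` is maximal at `x`.
  rcases monotoneOn_or_antitoneOn_of_derivative_ne_zero f hcrit with hm | hm
  · refine (min_le_left _ _).trans ?_
    have := main b fun t h0 h1 => by
      have hmem : x + t * (b - x) ∈ Set.Icc b c := ⟨by nlinarith, by nlinarith⟩
      have h2 : f.eval b ≤ f.eval (x + t * (b - x)) := hm hbm hmem hmem.1
      have h3 : f.eval (x + t * (b - x)) ≤ f.eval x := hm hmem hxm (by nlinarith)
      rw [abs_of_pos (hfb.trans_le h2), abs_of_pos hfx]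
      exact h3
    rwa [abs_sub_comm, abs_of_pos (sub_pos.2 hbx)] at this
  · refine (min_le_right _ _).trans ?_
    have := main c fun t h0 h1 => by
      have hmem : x + t * (c - x) ∈ Set.Icc b c := ⟨by nlinarith, by nlinarith⟩
      have h2 : f.eval c ≤ f.eval (x + t * (c - x)) := hm hmem hcm hmem.2
      have h3 : f.eval (x + t * (c - x)) ≤ f.eval x := hm hxm hmem (by nlinarith)
      rw [abs_of_pos (hfc.trans_le h2), abs_of_pos hfx]
      exact h3
    rwa [abs_of_pos (sub_pos.2 hxc)] at this

theorem eq_of_isCoprime_of_mul_eq_mul {p q : ℤ × ℤ} (hp : IsCoprime p.1 p.2)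
    (hq : IsCoprime q.1 q.2) (hp2 : 1 ≤ p.2) (hq2 : 1 ≤ q.2) (h : p.1 * q.2 = q.1 * p.2) :
    p = q := by
  have h1 : p.2 ∣ q.2 := hp.symm.dvd_of_dvd_mul_left ⟨q.1, by linarith⟩
  have h2 : q.2 ∣ p.2 := hq.symm.dvd_of_dvd_mul_left ⟨p.1, by linarith⟩
  have h3 : p.2 = q.2 := Int.dvd_antisymm (by omega) (by omega) h1 h2
  rw [← h3] at h
  exact Prod.ext (mul_right_cancel₀ (by omega) h) h3

/-- A double product over points and roots is estimated in both orders: from below point by point by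
`hprod`, from above root by root by the gap principle. The exceptional points account for `2 *
Z.card + 2`. -/
theorem card_le_of_prod_ge {ι : Type*} [Fintype ι] (hι : 0 < Fintype.card ι) (α : ι → ℂ) (a : ℂ)
    (f : ℝ[X]) (hf : ∀ t : ℝ, ((f.eval t : ℝ) : ℂ) = a * ∏ i, ((t : ℂ) - α i)) (Z : Finset ℝ)
    (hZ : ∀ t, f.derivative.eval t = 0 → t ∈ Z) {Y : ℝ} (hY : 1 ≤ Y) (T : Finset (ℤ × ℤ))
    (hcop : ∀ p ∈ T, IsCoprime p.1 p.2) (hy : ∀ p ∈ T, 1 ≤ p.2) (hyY : ∀ p ∈ T, (p.2 : ℝ) ≤ Y)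
    (hpos : ∀ p ∈ T, 0 < f.eval ((p.1 : ℝ) / p.2))
    (hprod : ∀ p ∈ T, (50 : ℝ) ^ Fintype.card ι ≤
      ∏ i, max 1 (1 / (p.2 * ‖(p.1 : ℂ) - α i * p.2‖))) :
    (T.card : ℝ) ≤ 2 * Z.card + 2 + Real.log (72 * (Fintype.card ι : ℝ) ^ 4 * Y) := by
  classical
  set n := Fintype.card ι with hn
  have hn1 : (1 : ℝ) ≤ n := by exact_mod_cast hι
  set ξ : ℤ × ℤ → ℝ := fun p => (p.1 : ℝ) / p.2 with hξ
  have hyR : ∀ p ∈ T, (1 : ℝ) ≤ p.2 := fun p hp => by exact_mod_cast hy p hp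
  have hdet : ∀ p ∈ T, ∀ q ∈ T, p ≠ q → p.1 * q.2 - q.1 * p.2 ≠ 0 := fun p hp q hq hpq h =>
    hpq (eq_of_isCoprime_of_mul_eq_mul (hcop p hp) (hcop q hq) (hy p hp) (hy q hq) (by linarith))
  have hsep : ∀ p ∈ T, ∀ q ∈ T, ξ p < ξ q → 1 ≤ (p.2 : ℝ) * q.2 * (ξ q - ξ p) := by
    intro p hp q hq hlt
    have h1 := hyR p hp
    have h2 := hyR q hq
    have e : (p.2 : ℝ) * q.2 * (ξ q - ξ p) = ((q.1 * p.2 - p.1 * q.2 : ℤ) : ℝ) := by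
      simp only [hξ]; push_cast; field_simp
    have h3 : 0 < (p.2 : ℝ) * q.2 * (ξ q - ξ p) := by
      have := sub_pos.2 hlt; positivity
    rw [e] at h3
    have h4 : (1 : ℝ) ≤ ((q.1 * p.2 - p.1 * q.2 : ℤ) : ℝ) := by
      exact_mod_cast (by exact_mod_cast h3 : 0 < q.1 * p.2 - p.1 * q.2)
    rwa [← e] at h4
  have hinj : Set.InjOn ξ T := by
    intro p hp q hq h
    by_contra hne
    refine hdet p hp q hq hne ?_
    have h1 : (p.2 : ℝ) ≠ 0 := by linarith [hyR p hp]
    have h2 : (q.2 : ℝ) ≠ 0 := by linarith [hyR q hq]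
    simp only [hξ] at h
    rw [div_eq_div_iff h1 h2] at h
    rw [sub_eq_zero]
    exact_mod_cast h
  obtain ⟨E, -, hEc, hE⟩ := exists_exceptional_subset (T.image ξ) Z
  set T' := T.filter fun p => ξ p ∉ E with hT'
  have hcard : T.card ≤ E.card + T'.card := by
    rw [← Finset.card_filter_add_card_filter_not (s := T) (fun p => ξ p ∈ E)]
    refine Nat.add_le_add_right ?_ _
    exact Finset.card_le_card_of_injOn ξ (fun p hp => (Finset.mem_filter.1 hp).2)
      (hinj.mono fun p hp => (Finset.mem_filter.1 hp).1)
  have hT'T : ∀ p ∈ T', p ∈ T := fun p hp => (Finset.mem_filter.1 hp).1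
  -- The separation of fractions gives `1 ≤ y Y · min(gaps)`, and the root estimate bounds this by
  -- `144 n⁴ Y |x - αᵢ y| = 2B |x - αᵢ y|`.
  set B := 72 * (n : ℝ) ^ 4 * Y with hB
  have hB1 : 1 ≤ B := by
    have : 1 ≤ (n : ℝ) ^ 4 := one_le_pow₀ hn1
    nlinarith
  have hl : ∀ p ∈ T', ∀ i, 0 < ‖(p.1 : ℂ) - α i * p.2‖ ∧ 1 / (2 * ‖(p.1 : ℂ) - α i * p.2‖) ≤ B := by
    intro p hp i
    have hpT := hT'T p hp
    obtain ⟨b, hb, c, hc, hbp, hpc, hz⟩ :=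
      hE (ξ p) (Finset.mem_image_of_mem _ hpT) (Finset.mem_filter.1 hp).2
    obtain ⟨q, hq, rfl⟩ := Finset.mem_image.1 hb
    obtain ⟨r, hr, rfl⟩ := Finset.mem_image.1 hc
    have h := min_sub_le_of_neighbours α a f hf hbp hpc (hpos q hq) (hpos p hpT) (hpos r hr)
      (fun t h1 h2 h3 => hz t (hZ t h3) ⟨h1, h2⟩) i
    have hp2 := hyR p hpT
    have h1 : 1 ≤ (p.2 : ℝ) * Y * min (ξ p - ξ q) (ξ r - ξ p) := by
      rcases min_choice (ξ p - ξ q) (ξ r - ξ p) with h | h <;> rw [h]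
      · have := sub_pos.2 hbp
        calc (1 : ℝ) ≤ q.2 * p.2 * (ξ p - ξ q) := hsep q hq p hpT hbp
          _ = p.2 * q.2 * (ξ p - ξ q) := by ring
          _ ≤ p.2 * Y * (ξ p - ξ q) := by gcongr; exact hyY q hq
      · have := sub_pos.2 hpc
        calc (1 : ℝ) ≤ p.2 * r.2 * (ξ r - ξ p) := hsep p hpT r hr hpc
          _ ≤ p.2 * Y * (ξ r - ξ p) := by gcongr; exact hyY r hr
    have e : ‖(p.1 : ℂ) - α i * p.2‖ = p.2 * ‖((ξ p : ℝ) : ℂ) - α i‖ := by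
      have h2 : (p.2 : ℂ) ≠ 0 := by
        have := hy p hpT
        exact_mod_cast (by omega : p.2 ≠ 0)
      have : (p.1 : ℂ) - α i * p.2 = (p.2 : ℂ) * (((ξ p : ℝ) : ℂ) - α i) := by
        simp only [hξ]; push_cast; field_simp
      rw [this, norm_mul, Complex.norm_intCast, abs_of_nonneg (by linarith)]
    have h2 : 1 ≤ 2 * B * ‖(p.1 : ℂ) - α i * p.2‖ := by
      rw [e]
      calc (1 : ℝ) ≤ (p.2 : ℝ) * Y * min (ξ p - ξ q) (ξ r - ξ p) := h1
        _ ≤ (p.2 : ℝ) * Y * (144 * (n : ℝ) ^ 4 * ‖((ξ p : ℝ) : ℂ) - α i‖) := by gcongr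
        _ = _ := by rw [hB]; ring
    have h3 : 0 < ‖(p.1 : ℂ) - α i * p.2‖ := by
      by_contra h0
      have : ‖(p.1 : ℂ) - α i * p.2‖ = 0 := le_antisymm (not_lt.1 h0) (norm_nonneg _)
      rw [this] at h2; norm_num at h2
    refine ⟨h3, ?_⟩
    rw [div_le_iff₀ (by positivity)]
    linarith
  have hup : ∏ i, ∏ p ∈ T', max 1 (1 / (p.2 * ‖(p.1 : ℂ) - α i * p.2‖)) ≤
      (2 ^ T'.card * B) ^ n := by
    rw [hn, ← Finset.card_univ, ← Finset.prod_const]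
    refine Finset.prod_le_prod (fun i _ => Finset.prod_nonneg fun p _ => by positivity)
      fun i _ => ?_
    exact prod_max_one_le_of_gap T' (α i) hB1 (fun p hp => hy p (hT'T p hp))
      (fun p hp q hq => hdet p (hT'T p hp) q (hT'T q hq)) (fun p hp => (hl p hp i).1)
      (fun p hp => (hl p hp i).2)
  have hlow : ((50 : ℝ) ^ n) ^ T'.card ≤
      ∏ p ∈ T', ∏ i, max 1 (1 / (p.2 * ‖(p.1 : ℂ) - α i * p.2‖)) := by
    rw [← Finset.prod_const]
    exact Finset.prod_le_prod (fun _ _ => by positivity) fun p hp => hprod p (hT'T p hp)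
  rw [Finset.prod_comm] at hlow
  have h50 : (50 : ℝ) ^ T'.card ≤ 2 ^ T'.card * B := by
    have := hlow.trans hup
    rw [← pow_mul, mul_comm n, pow_mul] at this
    exact le_of_pow_le_pow_left₀ (by omega) (by positivity) this
  have h25 : (25 : ℝ) ^ T'.card ≤ B := by
    rw [show (50 : ℝ) = 2 * 25 by norm_num, mul_pow] at h50
    exact le_of_mul_le_mul_left h50 (by positivity)
  have hlog : (T'.card : ℝ) ≤ Real.log B := by
    rw [Real.le_log_iff_exp_le (by linarith)]
    refine le_trans ?_ h25
    rw [← mul_one (T'.card : ℝ), Real.exp_nat_mul]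
    gcongr
    linarith [Real.exp_one_lt_d9]
  have h1 : (T.card : ℝ) ≤ E.card + T'.card := by exact_mod_cast hcard
  have h2 : (E.card : ℝ) ≤ 2 * Z.card + 2 := by exact_mod_cast hEc
  linarith

/-! ### Large Mahler measure forces good approximation. -/

/-- If every unimodular matrix with first column `(x, y)` gives a form of large Mahler measure,
then `x / y` is close to the roots on average. -/
theorem prod_max_ge_of_unimodular {ι : Type*} [Fintype ι] (α : ι → ℂ) (a : ℂ) {m : ℝ}
    {x y : ℤ} (hm : 0 < m) (hcop : IsCoprime x y) (hy : 1 ≤ y) (hl : ∀ i, (x : ℂ) - α i * y ≠ 0)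
    (hval : ‖a‖ * ∏ i, ‖(x : ℂ) - α i * y‖ ≤ m)
    (hM : ∀ p q : ℤ, x * q - p * y = 1 → 100 ^ Fintype.card ι * m ≤
      ‖a‖ * ∏ i, max ‖(x : ℂ) - α i * y‖ ‖(p : ℂ) - α i * q‖) :
    (50 : ℝ) ^ Fintype.card ι ≤ ∏ i, max 1 (1 / (y * ‖(x : ℂ) - α i * y‖)) := by
  obtain ⟨u, v, huv⟩ := hcop
  have hyR : (1 : ℝ) ≤ y := by exact_mod_cast hy
  -- Reducing the second column modulo the first gives `0 ≤ q < y`, whence `|p - α q| ≤ |x - α y| +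
  -- 1/y`.
  set q := u % y with hq
  have hq0 : 0 ≤ q := Int.emod_nonneg _ (by omega)
  have hqy : q < y := Int.emod_lt_of_pos _ (by omega)
  have hdet : x * q - (-v - x * (u / y)) * y = 1 := by
    rw [hq, Int.emod_def]; linarith
  set p := -v - x * (u / y) with hp
  have hstep : ∀ i, max ‖(x : ℂ) - α i * y‖ ‖(p : ℂ) - α i * q‖ ≤
      2 * ‖(x : ℂ) - α i * y‖ * max 1 (1 / (y * ‖(x : ℂ) - α i * y‖)) := by
    intro i
    set l := ‖(x : ℂ) - α i * y‖ with hldef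
    have hl0 : 0 < l := norm_pos_iff.2 (hl i)
    have e : (y : ℂ) * ((p : ℂ) - α i * q) = q * ((x : ℂ) - α i * y) - 1 := by
      have : (x : ℂ) * q - p * y = 1 := by exact_mod_cast hdet
      linear_combination -this
    have h1 : (y : ℝ) * ‖(p : ℂ) - α i * q‖ ≤ y * l + 1 := by
      have h2 := congrArg norm e
      rw [norm_mul, Complex.norm_intCast, abs_of_nonneg (by linarith)] at h2
      rw [h2]
      refine (norm_sub_le _ _).trans ?_
      rw [norm_mul, Complex.norm_intCast, norm_one,
        abs_of_nonneg (by exact_mod_cast hq0)]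
      have : (q : ℝ) ≤ y := by exact_mod_cast hqy.le
      gcongr
    have h3 : ‖(p : ℂ) - α i * q‖ ≤ l + 1 / y := by
      have : (y : ℝ) * ‖(p : ℂ) - α i * q‖ ≤ y * (l + 1 / y) := by
        rw [mul_add, mul_one_div_cancel (by linarith)]; exact h1
      exact le_of_mul_le_mul_left this (by linarith)
    have h4 : l ≤ l * max 1 (1 / (y * l)) := le_mul_of_one_le_right hl0.le (le_max_left _ _)
    have h5 : 1 / y ≤ l * max 1 (1 / (y * l)) := by
      calc 1 / (y : ℝ) = l * (1 / (y * l)) := by field_simp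
        _ ≤ _ := by gcongr; exact le_max_right _ _
    exact max_le (by linarith) (by linarith)
  have h1 := hM p q hdet
  have h2 : ‖a‖ * ∏ i, max ‖(x : ℂ) - α i * y‖ ‖(p : ℂ) - α i * q‖ ≤
      2 ^ Fintype.card ι * m * ∏ i, max 1 (1 / (y * ‖(x : ℂ) - α i * y‖)) := by
    calc _ ≤ ‖a‖ * ∏ i, (2 * ‖(x : ℂ) - α i * y‖ * max 1 (1 / (y * ‖(x : ℂ) - α i * y‖))) := by
          gcongr with i _
          exact hstep i
      _ = 2 ^ Fintype.card ι * (‖a‖ * ∏ i, ‖(x : ℂ) - α i * y‖) *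
            ∏ i, max 1 (1 / (y * ‖(x : ℂ) - α i * y‖)) := by
          rw [Finset.prod_mul_distrib, Finset.prod_mul_distrib, Finset.prod_const,
            Finset.card_univ]
          ring
      _ ≤ _ := by
          have : 0 ≤ ∏ i, max 1 (1 / (y * ‖(x : ℂ) - α i * y‖)) :=
            Finset.prod_nonneg fun i _ => by positivity
          gcongr
  have h3 := h1.trans h2
  rw [show (100 : ℝ) = 2 * 50 by norm_num, mul_pow] at h3
  have h4 : (0 : ℝ) < 2 ^ Fintype.card ι * m := by positivity
  refine le_of_mul_le_mul_left ?_ h4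
  linarith

/-! ### Binary forms: linear factors, Mahler measure, derivatives. -/

theorem natDegree_aeval_X_one_le {R : Type*} [CommRing R] {n : ℕ} {F : MvPolynomial (Fin 2) R}
    (hF : F.IsHomogeneous n) : (MvPolynomial.aeval ![(X : R[X]), 1] F).natDegree ≤ n := by
  rw [F.as_sum, map_sum]
  refine natDegree_sum_le_of_forall_le _ _ fun d hd => ?_
  have hdeg := hF (MvPolynomial.mem_support_iff.1 hd)
  rw [MvPolynomial.aeval_monomial, Finsupp.prod_fintype _ _ (by simp)]
  simp only [Fin.prod_univ_two, Matrix.cons_val_zero, Matrix.cons_val_one, one_pow, mul_one]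
  refine (natDegree_C_mul_X_pow_le _ _).trans ?_
  rw [← hdeg, Finsupp.weight_apply, Finsupp.sum_fintype _ _ (by simp)]
  simp

/-- An irreducible binary form of degree `n ≥ 2` is not divisible by `y`. -/
theorem natDegree_aeval_X_one_eq {K : Type*} [Field K] {n : ℕ} (hn : 2 ≤ n)
    {F : MvPolynomial (Fin 2) K} (hF : F.IsHomogeneous n) (hirr : Irreducible F) :
    (MvPolynomial.aeval ![(X : K[X]), 1] F).natDegree = n := by
  refine le_antisymm (natDegree_aeval_X_one_le hF) ?_
  by_contra hlt
  set f := MvPolynomial.aeval ![(X : K[X]), 1] F with hf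
  have h1 : f.homogenize n = F := homogenize_eq_of_isHomogeneous hF rfl
  have h2 : F = f.homogenize (n - 1) * MvPolynomial.X 1 := by
    have := homogenize_mul f 1 (m := n - 1) (n := 1) (by omega) (by simp)
    rw [mul_one, show n - 1 + 1 = n by omega, h1, homogenize_one, pow_one] at this
    exact this
  -- Since `n ≥ 2`, the cofactor of `y` has positive degree `n - 1`, so neither factor is a unit.
  rcases hirr.isUnit_or_isUnit h2 with hu | hu
  · have hne : f.homogenize (n - 1) ≠ 0 := hu.ne_zero
    have := (isHomogeneous_homogenize (n := n - 1) f).totalDegree hne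
    rw [MvPolynomial.isUnit_iff_totalDegree_of_isReduced] at hu
    omega
  · have := (MvPolynomial.isUnit_iff_totalDegree_of_isReduced.1 hu).2
    simp at this

theorem map_aeval_X_one {R S : Type*} [CommRing R] [CommRing S] (φ : R →+* S)
    (F : MvPolynomial (Fin 2) R) :
    (MvPolynomial.aeval ![(X : R[X]), 1] F).map φ =
      MvPolynomial.aeval ![(X : S[X]), 1] (MvPolynomial.map φ F) := by
  induction F using MvPolynomial.induction_on with
  | C a => simp
  | add p q hp hq => simp [hp, hq]
  | mul_X p i hp =>
    rw [map_mul, Polynomial.map_mul, hp, map_mul, map_mul]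
    fin_cases i <;> simp

/-- A binary form, irreducible over `ℚ`, is a product of linear forms over `ℂ`. -/
theorem exists_linear_factorization {n : ℕ} (hn : 2 ≤ n) {F : MvPolynomial (Fin 2) ℤ}
    (hF : F.IsHomogeneous n) (hirr : Irreducible (MvPolynomial.map (Int.castRingHom ℚ) F)) :
    ∃ (a : ℂ) (α : Fin n → ℂ), MvPolynomial.map (Int.castRingHom ℂ) F =
      MvPolynomial.C a * ∏ i, (MvPolynomial.X 0 - MvPolynomial.C (α i) * MvPolynomial.X 1) := by
  set f := MvPolynomial.aeval ![(X : ℂ[X]), 1] (MvPolynomial.map (Int.castRingHom ℂ) F) with hf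
  have hdeg : f.natDegree = n := by
    rw [← natDegree_aeval_X_one_eq hn (hF.map (Int.castRingHom ℚ)) hirr, hf,
      ← map_aeval_X_one, ← map_aeval_X_one,
      natDegree_map_eq_of_injective (RingHom.injective_int _),
      natDegree_map_eq_of_injective (RingHom.injective_int _)]
  have hcard : Fintype.card f.roots = n := by
    rw [Multiset.card_coe, ← (IsAlgClosed.splits f).natDegree_eq_card_roots, hdeg]
  set e := Fintype.equivFinOfCardEq hcard
  refine ⟨f.leadingCoeff, fun i => ((e.symm i : f.roots) : ℂ), ?_⟩
  have hprod : f = C f.leadingCoeff * ∏ i : Fin n, (X - C ((e.symm i : f.roots) : ℂ)) := by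
    rw [Fintype.prod_equiv e.symm _ (fun r : f.roots => (X - C (r : ℂ))) (fun _ => rfl)]
    conv_lhs => rw [(IsAlgClosed.splits f).eq_prod_roots]
    congr 1
    conv_lhs => rw [← Multiset.map_univ_coe f.roots, Multiset.map_map]
    rfl
  rw [← homogenize_eq_of_isHomogeneous (hF.map (Int.castRingHom ℂ)) hf.symm]
  refine homogenize_eq_of_isHomogeneous ?_ ?_
  · have h1 := (MvPolynomial.IsHomogeneous.prod Finset.univ
      (fun i : Fin n => (MvPolynomial.X 0 - MvPolynomial.C ((e.symm i : f.roots) : ℂ) *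
        MvPolynomial.X 1 : MvPolynomial (Fin 2) ℂ)) (fun _ => 1) fun i _ =>
        (MvPolynomial.isHomogeneous_X ℂ 0).sub (MvPolynomial.isHomogeneous_C_mul_X _ 1))
    have h2 := (MvPolynomial.isHomogeneous_C (Fin 2) f.leadingCoeff).mul h1
    simpa using h2
  · conv_rhs => rw [hprod]
    simp [map_prod]

theorem mahlerMeasure_finset_prod {ι : Type*} (s : Finset ι) (p : ι → ℂ[X]) :
    (∏ i ∈ s, p i).mahlerMeasure = ∏ i ∈ s, (p i).mahlerMeasure := by
  classical
  induction s using Finset.induction_on with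
  | empty => simp
  | insert a s ha ih => rw [Finset.prod_insert ha, Finset.prod_insert ha, mahlerMeasure_mul, ih]

theorem aeval_eq_of_factorization {n : ℕ} {F : MvPolynomial (Fin 2) ℤ} {a : ℂ} {α : Fin n → ℂ}
    (hfac : MvPolynomial.map (Int.castRingHom ℂ) F =
      MvPolynomial.C a * ∏ i, (MvPolynomial.X 0 - MvPolynomial.C (α i) * MvPolynomial.X 1))
    {A : Type*} [CommRing A] [Algebra ℂ A] [Algebra ℤ A] (g : Fin 2 → A) :
    MvPolynomial.aeval g F = algebraMap ℂ A a * ∏ i, (g 0 - algebraMap ℂ A (α i) * g 1) := by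
  have h := congrArg (MvPolynomial.eval₂ (algebraMap ℂ A) g) hfac
  rw [MvPolynomial.eval₂_map, RingHom.ext_int ((algebraMap ℂ A).comp _) (algebraMap ℤ A)] at h
  rw [MvPolynomial.aeval_def, h]
  simp

/-- The Mahler measure is multiplicative, and that of a linear polynomial is the larger absolute
value of its two coefficients. -/
theorem mahler_act {n : ℕ} {F : MvPolynomial (Fin 2) ℤ} {a : ℂ} {α : Fin n → ℂ}
    (hfac : MvPolynomial.map (Int.castRingHom ℂ) F =
      MvPolynomial.C a * ∏ i, (MvPolynomial.X 0 - MvPolynomial.C (α i) * MvPolynomial.X 1))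
    (A : Matrix (Fin 2) (Fin 2) ℤ) (hA : ∀ i, (A 0 0 : ℂ) - α i * A 1 0 ≠ 0) :
    mahler (act A F) =
      ‖a‖ * ∏ i, max ‖(A 0 0 : ℂ) - α i * A 1 0‖ ‖(A 0 1 : ℂ) - α i * A 1 1‖ := by
  rw [mahler, act, MvPolynomial.aeval_bind₁, aeval_eq_of_factorization hfac, mahlerMeasure_mul,
    mahlerMeasure_finset_prod]
  congr 1
  · exact mahlerMeasure_const a
  · refine Finset.prod_congr rfl fun i _ => ?_
    rw [← mahlerMeasure_C_mul_X_add_C (hA i)]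
    congr 1
    simp
    ring

theorem minMahler_le (F : MvPolynomial (Fin 2) ℤ) {x y p q : ℤ} (h : IsUnit (x * q - p * y)) :
    minMahler F ≤ mahler (act !![x, p; y, q] F) := by
  refine csInf_le ⟨0, ?_⟩ ?_
  · rintro _ ⟨G, -, rfl⟩
    exact mahlerMeasure_nonneg _
  · have hdet : IsUnit (!![x, p; y, q] : Matrix (Fin 2) (Fin 2) ℤ).det := by
      rwa [Matrix.det_fin_two_of]
    exact ⟨_, ⟨Matrix.GeneralLinearGroup.mk'' _ hdet, Or.inl rfl⟩, rfl⟩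

theorem eval_derivative_aeval_X_one (F : MvPolynomial (Fin 2) ℝ) (t : ℝ) :
    (MvPolynomial.aeval ![(X : ℝ[X]), 1] F).derivative.eval t =
      MvPolynomial.eval ![t, 1] (MvPolynomial.pderiv 0 F) := by
  have hev : ∀ G : MvPolynomial (Fin 2) ℝ,
      (MvPolynomial.aeval ![(X : ℝ[X]), 1] G).eval t = MvPolynomial.eval ![t, 1] G := by
    intro G
    induction G using MvPolynomial.induction_on with
    | C a => simp
    | add p q hp hq => simp [hp, hq]
    | mul_X p i hp =>
      rw [map_mul, eval_mul, hp, map_mul]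
      fin_cases i <;> simp
  induction F using MvPolynomial.induction_on with
  | C a => simp
  | add p q hp hq => simp [hp, hq]
  | mul_X p i hp =>
    rw [map_mul, derivative_mul, eval_add, eval_mul, eval_mul, hp, Derivation.leibniz, map_add,
      hev]
    fin_cases i <;> simp [MvPolynomial.pderiv_X, hev, mul_comm, add_comm]

theorem intCast_eval (F : MvPolynomial (Fin 2) ℤ) (x y : ℤ) :
    ((MvPolynomial.eval ![x, y] F : ℤ) : ℂ) = MvPolynomial.aeval ![(x : ℂ), (y : ℂ)] F := by
  induction F using MvPolynomial.induction_on with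
  | C a => simp
  | add p q hp hq => simp [hp, hq]
  | mul_X p i hp =>
    rw [map_mul, map_mul, Int.cast_mul, hp]
    fin_cases i <;> simp

theorem ofReal_eval_aeval_X_one (F : MvPolynomial (Fin 2) ℤ) (t : ℝ) :
    (((MvPolynomial.aeval ![(X : ℝ[X]), 1] (toReal F)).eval t : ℝ) : ℂ) =
      MvPolynomial.aeval ![(t : ℂ), 1] F := by
  induction F using MvPolynomial.induction_on with
  | C a => simp [toReal]
  | add p q hp hq =>
    simp only [toReal, map_add, eval_add, Complex.ofReal_add] at hp hq ⊢
    rw [hp, hq]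
  | mul_X p i hp =>
    simp only [toReal, map_mul, eval_mul, Complex.ofReal_mul] at hp ⊢
    rw [hp]
    fin_cases i <;> simp

/-! ### Counting solutions with bounded second coordinate. -/

/-- The number of primitive points with `1 ≤ y ≤ Y` at which the form takes values in `(0, m)`. -/
theorem card_primitive_points_le {n m k : ℕ} (hn : 2 ≤ n) (hm : 1 ≤ m)
    {F : MvPolynomial (Fin 2) ℤ} (hF : F.IsHomogeneous n)
    (hirr : Irreducible (MvPolynomial.map (Int.castRingHom ℚ) F))
    (hZ : {t : ℝ | MvPolynomial.eval ![t, 1] (MvPolynomial.pderiv 0 (toReal F)) = 0}.encard ≤ k)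
    (hM : ∀ x y p q : ℤ, x * q - p * y = 1 →
      (100 : ℝ) ^ n * m ≤ mahler (act !![x, p; y, q] F))
    {Y : ℝ} (hY : 1 ≤ Y) (T : Finset (ℤ × ℤ)) (hcop : ∀ p ∈ T, IsCoprime p.1 p.2)
    (hy : ∀ p ∈ T, 1 ≤ p.2) (hyY : ∀ p ∈ T, (p.2 : ℝ) ≤ Y)
    (hpos : ∀ p ∈ T, 0 < MvPolynomial.eval ![p.1, p.2] F)
    (hlt : ∀ p ∈ T, MvPolynomial.eval ![p.1, p.2] F < m) :
    (T.card : ℝ) ≤ 2 * k + 2 + Real.log (72 * (n : ℝ) ^ 4 * Y) := by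
  obtain ⟨a, α, hfac⟩ := exists_linear_factorization hn hF hirr
  set f : ℝ[X] := MvPolynomial.aeval ![(X : ℝ[X]), 1] (toReal F) with hf
  have hfin : {t : ℝ | MvPolynomial.eval ![t, 1] (MvPolynomial.pderiv 0 (toReal F)) = 0}.Finite :=
    Set.finite_of_encard_le_coe hZ
  have hder : ∀ t, f.derivative.eval t =
      MvPolynomial.eval ![t, 1] (MvPolynomial.pderiv 0 (toReal F)) := fun t =>
    eval_derivative_aeval_X_one _ t
  have hval : ∀ x y : ℤ, ((MvPolynomial.eval ![x, y] F : ℤ) : ℂ) =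
      a * ∏ i, ((x : ℂ) - α i * y) := by
    intro x y
    have := aeval_eq_of_factorization hfac ![(x : ℂ), (y : ℂ)]
    rw [← intCast_eval] at this
    simpa using this
  have hfe : ∀ t : ℝ, ((f.eval t : ℝ) : ℂ) = a * ∏ i, ((t : ℂ) - α i) := by
    intro t
    have := aeval_eq_of_factorization hfac ![(t : ℂ), 1]
    simp only [Algebra.algebraMap_self, RingHom.id_apply, Matrix.cons_val_zero,
      Matrix.cons_val_one, mul_one] at this
    rw [← this, hf]
    exact ofReal_eval_aeval_X_one F t
  have hnn : ∀ p ∈ T, ∀ i, (p.1 : ℂ) - α i * p.2 ≠ 0 := by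
    intro p hp i h0
    have := hval p.1 p.2
    rw [Finset.prod_eq_zero (Finset.mem_univ i) h0, mul_zero] at this
    exact (hpos p hp).ne' (by exact_mod_cast this)
  have key := card_le_of_prod_ge (ι := Fin n) (by simp; omega) α a f hfe hfin.toFinset
    (fun t ht => by rw [Set.Finite.mem_toFinset]; exact (hder t).symm.trans ht) hY T hcop hy hyY
    (fun p hp => by
      have hp2 : (0 : ℝ) < p.2 := by exact_mod_cast hy p hp
      have hp2' : (p.2 : ℂ) ≠ 0 := by exact_mod_cast hp2.ne'
      have e : (p.2 : ℝ) ^ n * f.eval ((p.1 : ℝ) / p.2) = (MvPolynomial.eval ![p.1, p.2] F : ℤ) := by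
        have : (((p.2 : ℝ) ^ n * f.eval ((p.1 : ℝ) / p.2) : ℝ) : ℂ) =
            ((MvPolynomial.eval ![p.1, p.2] F : ℤ) : ℂ) := by
          rw [Complex.ofReal_mul, hfe, hval]
          have hc : ((p.2 : ℝ) ^ n : ℝ) = ((∏ _i : Fin n, (p.2 : ℝ) : ℝ) : ℝ) := by simp
          rw [hc]
          push_cast
          rw [mul_left_comm, ← Finset.prod_mul_distrib]
          congr 1
          refine Finset.prod_congr rfl fun i _ => ?_
          field_simp
        exact_mod_cast this
      have h1 : (0 : ℝ) < (p.2 : ℝ) ^ n * f.eval ((p.1 : ℝ) / p.2) := by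
        rw [e]; exact_mod_cast hpos p hp
      exact pos_of_mul_pos_right h1 (by positivity))
    (fun p hp => by
      refine prod_max_ge_of_unimodular α a (m := m) (by exact_mod_cast hm) (hcop p hp) (hy p hp)
        (hnn p hp) ?_ ?_
      · rw [← norm_prod, ← norm_mul, ← hval, Complex.norm_intCast,
          abs_of_pos (by exact_mod_cast hpos p hp)]
        exact_mod_cast (hlt p hp).le
      · intro u v huv
        have := hM p.1 p.2 u v huv
        rw [mahler_act hfac _ (hnn p hp)] at this
        simpa using this)
  have hk : (hfin.toFinset.card : ℝ) ≤ k := by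
    rw [hfin.encard_eq_coe_toFinset_card] at hZ
    exact_mod_cast hZ
  rw [Fintype.card_fin] at key
  linarith

/-- From `n ≥ 3s` follows `n - 2s ≥ n/3`, so the exponent is at most `3/n`. The contribution of `R`
is then at most `1600 log³ n`, because `3s/n ≤ 1`. -/
theorem log_YS_le {n s m : ℕ} (hs : 1 ≤ s) (hn : 3 * s ≤ n) (hm : 1 ≤ m) :
    1 ≤ YS n s m ∧
      Real.log (YS n s m) ≤ 21 * s + 1600 * Real.log n ^ 3 + 3 * Real.log ((m : ℝ) ^ (1 / (n : ℝ))) := by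
  have hsR : (1 : ℝ) ≤ s := by exact_mod_cast hs
  have hmR : (1 : ℝ) ≤ m := by exact_mod_cast hm
  have hnR : 3 * (s : ℝ) ≤ n := by exact_mod_cast hn
  have hn1 : (1 : ℝ) ≤ n := by linarith
  have hln : 0 ≤ Real.log n := Real.log_nonneg hn1
  have hlm : 0 ≤ Real.log m := Real.log_nonneg hmR
  have hls : 0 ≤ Real.log s := Real.log_nonneg hsR
  have hls' : Real.log s ≤ s := (Real.log_le_sub_one_of_pos (by linarith)).trans (by linarith)
  have hR : 1 ≤ R n := Real.one_le_rpow hn1 (by positivity)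
  have hlR : Real.log (R n) = 800 * Real.log n ^ 3 := by
    rw [R, Real.log_rpow (by linarith)]; ring
  have he : 1 ≤ Real.exp 6 * s := one_le_mul_of_one_le_of_one_le (Real.one_le_exp (by norm_num)) hsR
  have hbase : 1 ≤ (Real.exp 6 * s) ^ n * R n ^ (2 * s) * m :=
    one_le_mul_of_one_le_of_one_le
      (one_le_mul_of_one_le_of_one_le (one_le_pow₀ he) (one_le_pow₀ hR)) hmR
  have hd : 0 < (n : ℝ) - 2 * s := by linarith
  refine ⟨Real.one_le_rpow hbase (by positivity), ?_⟩
  rw [YS, Real.log_rpow (by linarith), Real.log_rpow (by linarith),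
    Real.log_mul (by positivity) (by positivity), Real.log_mul (by positivity) (by positivity),
    Real.log_pow, Real.log_pow, Real.log_mul (by positivity) (by positivity), Real.log_exp, hlR]
  set L := Real.log n ^ 3 with hL
  have hL0 : 0 ≤ L := by positivity
  have h1 : 1 / ((n : ℝ) - 2 * s) ≤ 3 / n := by
    rw [div_le_div_iff₀ hd (by linarith)]; linarith
  push_cast
  calc 1 / ((n : ℝ) - 2 * s) * (n * (6 + Real.log s) + 2 * s * (800 * L) + Real.log m)
      ≤ 3 / n * (n * (6 + Real.log s) + 2 * s * (800 * L) + Real.log m) := by gcongr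
    _ = 18 + 3 * Real.log s + 1600 * L * (3 * s / n) + 3 * (1 / n * Real.log m) := by
        field_simp; ring
    _ ≤ 18 + 3 * Real.log s + 1600 * L * 1 + 3 * (1 / n * Real.log m) := by
        gcongr
        rw [div_le_one (by linarith)]; exact hnR
    _ ≤ _ := by linarith

/-- The primitive points with second coordinate in `[0, Y_S]` at which the form takes positive
values less than `m` are few. -/
theorem finite_and_ncard_le {n s m : ℕ} (hs : 1 ≤ s) (hn : 3 * s ≤ n) (hm : 1 ≤ m)
    {F : MvPolynomial (Fin 2) ℤ} (hF : F.IsHomogeneous n)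
    (hirr : Irreducible (MvPolynomial.map (Int.castRingHom ℚ) F))
    (hZ : {t : ℝ | MvPolynomial.eval ![t, 1] (MvPolynomial.pderiv 0 (toReal F)) = 0}.encard ≤
      (4 * s - 2 : ℕ))
    (hM : ∀ x y p q : ℤ, x * q - p * y = 1 →
      (100 : ℝ) ^ n * m ≤ mahler (act !![x, p; y, q] F)) :
    (smallY n s m F).Finite ∧ ((smallY n s m F).ncard : ℝ) ≤
      2000 * ((s : ℝ) + Real.log n ^ 3 + Real.log ((m : ℝ) ^ (1 / (n : ℝ)))) := by
  obtain ⟨hY, hlY⟩ := log_YS_le hs hn hm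
  set S := (s : ℝ) + Real.log n ^ 3 + Real.log ((m : ℝ) ^ (1 / (n : ℝ))) with hS
  have hsR : (1 : ℝ) ≤ s := by exact_mod_cast hs
  have hnR : (3 : ℝ) ≤ n := by exact_mod_cast (by omega : 3 ≤ n)
  have hmR : (1 : ℝ) ≤ m := by exact_mod_cast hm
  -- As `n ≥ 3 > e`, the term `4 log n` can be absorbed into `log³ n`.
  have hln : 1 ≤ Real.log n := by
    rw [Real.le_log_iff_exp_le (by linarith)]
    linarith [Real.exp_one_lt_d9]
  have hlm : 0 ≤ Real.log ((m : ℝ) ^ (1 / (n : ℝ))) :=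
    Real.log_nonneg (Real.one_le_rpow hmR (by positivity))
  have hbound : ∀ T : Finset (ℤ × ℤ), (T : Set (ℤ × ℤ)) ⊆ smallY n s m F →
      (T.card : ℝ) ≤ 2000 * S := by
    intro T hT
    classical
    -- A primitive point with `y = 0` is `(±1, 0)`.
    have h0 : (T.filter fun p => ¬ 1 ≤ p.2).card ≤ 2 := by
      refine (Finset.card_le_card (t := {((1 : ℤ), (0 : ℤ)), (-1, 0)}) fun p hp => ?_).trans
        Finset.card_le_two
      obtain ⟨hpT, hp1⟩ := Finset.mem_filter.1 hp
      obtain ⟨⟨hc, -⟩, hp0, -⟩ := hT hpT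
      have hp2 : p.2 = 0 := by omega
      rw [hp2, isCoprime_zero_right, Int.isUnit_iff] at hc
      rcases hc with h | h
      · exact Finset.mem_insert.2 (Or.inl (Prod.ext h hp2))
      · exact Finset.mem_insert.2 (Or.inr (Finset.mem_singleton.2 (Prod.ext h hp2)))
    have h1 := card_primitive_points_le (by omega) hm hF hirr hZ hM hY (T.filter fun p => 1 ≤ p.2)
      (fun p hp => (hT (Finset.mem_filter.1 hp).1).1.1) (fun p hp => (Finset.mem_filter.1 hp).2)
      (fun p hp => (hT (Finset.mem_filter.1 hp).1).2.2)
      -- The lower bound `2⁻ⁿ m` enters only through the positivity of the value.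
      (fun p hp => by
        have := (hT (Finset.mem_filter.1 hp).1).1.2.1
        have h2 : (0 : ℝ) < (2 : ℝ) ^ (-(n : ℤ)) * m := by positivity
        exact_mod_cast h2.trans_le this)
      (fun p hp => by exact_mod_cast (hT (Finset.mem_filter.1 hp).1).1.2.2)
    have h2 : (T.card : ℝ) = (T.filter fun p => 1 ≤ p.2).card +
        (T.filter fun p => ¬ 1 ≤ p.2).card := by
      exact_mod_cast (Finset.card_filter_add_card_filter_not (s := T) (fun p => 1 ≤ p.2)).symm
    have h0' : ((T.filter fun p => ¬ 1 ≤ p.2).card : ℝ) ≤ 2 := by exact_mod_cast h0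
    have h3 : ((4 * s - 2 : ℕ) : ℝ) ≤ 4 * s := by exact_mod_cast Nat.sub_le _ _
    have h4 : Real.log (72 * (n : ℝ) ^ 4 * YS n s m) =
        Real.log 72 + 4 * Real.log n + Real.log (YS n s m) := by
      rw [Real.log_mul (by positivity) (by positivity), Real.log_mul (by positivity) (by positivity),
        Real.log_pow]
      norm_num
    have h5 : Real.log 72 ≤ 72 := (Real.log_le_sub_one_of_pos (by norm_num)).trans (by norm_num)
    have h6 : Real.log n ≤ Real.log n ^ 3 := le_self_pow₀ hln (by norm_num)
    rw [h4] at h1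
    rw [hS]
    linarith
  have hfin : (smallY n s m F).Finite := by
    -- An infinite set would have finite subsets exceeding the uniform bound.
    by_contra hinf
    obtain ⟨T, hT, hc⟩ := Set.Infinite.exists_subset_card_eq hinf (⌊2000 * S⌋₊ + 1)
    have := hbound T hT
    rw [hc] at this
    push_cast at this
    linarith [Nat.lt_floor_add_one (2000 * S)]
  refine ⟨hfin, ?_⟩
  rw [Set.ncard_eq_toFinset_card _ hfin]
  exact hbound _ (by simp)

/-! ### Critical points in affine charts and the exchange of variables. -/

/-- The map `φ` parametrizes an affine chart: `hinj` says that distinct parameters give distinct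
lines, and homogeneity spreads a zero over its whole line. -/
theorem encard_le_encard_realZeros {d : ℕ} {G : MvPolynomial (Fin 2) ℝ} (hG : G.IsHomogeneous d)
    (φ : ℝ → Fin 2 → ℝ) (hφ : ∀ t, φ t ≠ 0) (hinj : ∀ (t u c : ℝ), c • φ u = φ t → t = u) :
    {t : ℝ | MvPolynomial.eval (φ t) G = 0}.encard ≤ (realZeros G).encard := by
  refine Set.encard_le_encard_of_injOn (f := fun t => Projectivization.mk ℝ (φ t) (hφ t)) ?_ ?_
  · intro t ht v hv
    rw [Projectivization.submodule_mk, Submodule.mem_span_singleton] at hv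
    obtain ⟨c, rfl⟩ := hv
    have ht' : MvPolynomial.eval (φ t) G = 0 := ht
    have h : MvPolynomial.eval (c • φ t) G = c ^ d * MvPolynomial.eval (φ t) G := by
      rw [MvPolynomial.eval_eq', MvPolynomial.eval_eq', Finset.mul_sum]
      refine Finset.sum_congr rfl fun e he => ?_
      have hdeg := hG (MvPolynomial.mem_support_iff.1 he)
      rw [Finsupp.weight_apply, Finsupp.sum_fintype _ _ (by simp), Fin.sum_univ_two] at hdeg
      simp only [Pi.one_apply, smul_eq_mul, mul_one] at hdeg
      simp only [Fin.prod_univ_two, Pi.smul_apply, smul_eq_mul, ← hdeg]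
      ring
    rw [h, ht', mul_zero]
  · intro t _ u _ h
    obtain ⟨c, hc⟩ := (Projectivization.mk_eq_mk_iff' ℝ _ _ (hφ t) (hφ u)).1 h
    exact hinj t u c hc

/-- Only `(u, v) = (1, 0)` and `(0, 1)` are needed: `F_x(r, 1)` and `F_y(1, r)` are the derivatives
of the two dehomogenizations. -/
theorem encard_critical_points_le {n t : ℕ} {F : MvPolynomial (Fin 2) ℤ} (hF : ClassC n t F) :
    {r : ℝ | MvPolynomial.eval ![r, 1] (MvPolynomial.pderiv 0 (toReal F)) = 0}.encard ≤ t ∧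
      {r : ℝ | MvPolynomial.eval ![1, r] (MvPolynomial.pderiv 1 (toReal F)) = 0}.encard ≤ t := by
  have hhom : (toReal F).IsHomogeneous n := hF.homogeneous.map _
  constructor
  · have h := hF.few_zeros 1 0 (by simp)
    rw [map_one, one_mul, map_zero, zero_mul, add_zero] at h
    refine (encard_le_encard_realZeros hhom.pderiv (fun r => ![r, 1]) (fun r h => ?_) ?_).trans h
    · simpa using congrFun h 1
    · intro r u c h
      have h0 := congrFun h 0
      have h1 := congrFun h 1
      simp at h0 h1
      rw [← h0, h1, one_mul]
  · have h := hF.few_zeros 0 1 (by simp)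
    rw [map_one, one_mul, map_zero, zero_mul, zero_add] at h
    refine (encard_le_encard_realZeros hhom.pderiv (fun r => ![1, r]) (fun r h => ?_) ?_).trans h
    · simpa using congrFun h 0
    · intro r u c h
      have h0 := congrFun h 0
      have h1 := congrFun h 1
      simp at h0 h1
      rw [← h1, h0, one_mul]

/-- The form `F(y, x)`. -/
noncomputable def swapForm {R : Type*} [CommSemiring R] (F : MvPolynomial (Fin 2) R) :
    MvPolynomial (Fin 2) R :=
  MvPolynomial.rename (Equiv.swap 0 1) F

theorem eval_swapForm {R : Type*} [CommSemiring R] (F : MvPolynomial (Fin 2) R) (x y : R) :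
    MvPolynomial.eval ![x, y] (swapForm F) = MvPolynomial.eval ![y, x] F := by
  rw [swapForm, MvPolynomial.eval_rename]
  congr 2
  ext i
  fin_cases i <;> simp

theorem map_swapForm {R S : Type*} [CommSemiring R] [CommSemiring S] (φ : R →+* S)
    (F : MvPolynomial (Fin 2) R) :
    MvPolynomial.map φ (swapForm F) = swapForm (MvPolynomial.map φ F) :=
  MvPolynomial.map_rename _ _ _

theorem pderiv_zero_swapForm {R : Type*} [CommSemiring R] (F : MvPolynomial (Fin 2) R) :
    MvPolynomial.pderiv 0 (swapForm F) = swapForm (MvPolynomial.pderiv 1 F) := by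
  have := MvPolynomial.pderiv_rename (R := R) (Equiv.swap (0 : Fin 2) 1).injective 1 F
  rwa [Equiv.swap_apply_right] at this

theorem irreducible_swapForm {R : Type*} [CommSemiring R] {F : MvPolynomial (Fin 2) R}
    (hF : Irreducible F) : Irreducible (swapForm F) :=
  (MulEquiv.irreducible_iff
    (MvPolynomial.renameEquiv R (Equiv.swap (0 : Fin 2) 1)).toMulEquiv).2 hF

theorem act_swapForm (F : MvPolynomial (Fin 2) ℤ) (x y p q : ℤ) :
    act !![x, p; y, q] (swapForm F) = act !![y, q; x, p] F := by
  rw [act, act, swapForm, MvPolynomial.bind₁_rename]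
  congr 2
  ext i : 1
  fin_cases i <;> simp

theorem image_swap_smallX (n s m : ℕ) (F : MvPolynomial (Fin 2) ℤ) :
    Set.image Prod.swap (smallX n s m F) = smallY n s m (swapForm F) := by
  ext ⟨x, y⟩
  simp only [Set.mem_image, smallX, smallY, Set.mem_ofPred_eq, IsPrimitiveSolution, eval_swapForm,
    Prod.exists, Prod.swap_prod_mk, Prod.mk.injEq]
  constructor
  · rintro ⟨u, v, ⟨⟨hc, h⟩, h'⟩, rfl, rfl⟩
    exact ⟨⟨hc.symm, h⟩, h'⟩
  · rintro ⟨⟨hc, h⟩, h'⟩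
    exact ⟨y, x, ⟨⟨hc.symm, h⟩, h'⟩, rfl, rfl⟩

end ThueForms

/-! ### Both coordinates together. -/

theorem proposition8p3 :
    ∃ K : ℝ, 0 < K ∧
      ∀ (n s m : ℕ) (F : MvPolynomial (Fin 2) ℤ),
        1 ≤ s → 3 * s ≤ n → 1 ≤ m →
        ThueForms.ClassC n (4 * s - 2) F →
        (m : ℝ) ≤ ThueForms.minMahler F / 100 ^ n →
        (ThueForms.smallX n s m F).Finite ∧ (ThueForms.smallY n s m F).Finite ∧
        (max (ThueForms.smallX n s m F).ncard (ThueForms.smallY n s m F).ncard : ℝ) ≤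
          K * ((s : ℝ) + Real.log n ^ 3 + Real.log ((m : ℝ) ^ (1 / (n : ℝ)))) := by
  refine ⟨2000, by norm_num, fun n s m F hs hn hm hF hM => ?_⟩
  obtain ⟨hZ, hZ'⟩ := ThueForms.encard_critical_points_le hF
  -- Determinant `-1` must be allowed as well: exchanging the variables exchanges the rows of the
  -- matrix and flips the sign.
  have hM' : ∀ x y p q : ℤ, IsUnit (x * q - p * y) →
      (100 : ℝ) ^ n * m ≤ ThueForms.mahler (ThueForms.act !![x, p; y, q] F) := by
    intro x y p q h
    refine le_trans ?_ (ThueForms.minMahler_le F h)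
    rwa [le_div_iff₀ (by positivity), mul_comm] at hM
  obtain ⟨hfinY, hY⟩ := ThueForms.finite_and_ncard_le hs hn hm hF.homogeneous hF.irreducible hZ
    fun x y p q h => hM' x y p q (h ▸ isUnit_one)
  obtain ⟨hfinX, hX⟩ := ThueForms.finite_and_ncard_le hs hn hm (F := ThueForms.swapForm F)
    (hF.homogeneous.rename_isHomogeneous)
    (by rw [ThueForms.map_swapForm]; exact ThueForms.irreducible_swapForm hF.irreducible)
    (by
      rw [ThueForms.toReal, ThueForms.map_swapForm, ThueForms.pderiv_zero_swapForm]
      simp only [ThueForms.eval_swapForm]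
      exact hZ')
    (fun x y p q h => by
      rw [ThueForms.act_swapForm]
      exact hM' y x q p (by rw [show y * p - q * x = -1 by linarith]; exact isUnit_one.neg))
  rw [← ThueForms.image_swap_smallX] at hfinX hX
  rw [Set.ncard_image_of_injective _ Prod.swap_injective] at hX
  exact ⟨hfinX.of_finite_image Prod.swap_injective.injOn, hfinY, max_le hX hY⟩
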